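/- Let $d\ge 1$ be an integer and let $\lambda$ denote Lebesgue measure on $\mathbb{R}^d$. A cube in $\mathbb{R}^d$ means a closed cube with sides parallel to the axes, i.e. a cartesian product of $d$ bounded closed intervals, all of the same positive length. Let $JS(d)$ be the set of all ordered pairs $(\tau,s)$ of positive real numbers with the following property (that is, the John–Strömberg pairs for the collection of all cubes in $\mathbb{R}^d$): for every cube $Q$ in $\mathbb{R}^d$ and all disjoint Lebesgue measurable subsets $E_+,E_-$ of $Q$ satisfying $$\min\{\lambda(E_+),\lambda(E_-)\}>\tau\,\lambda(Q\setminus E_+\setminus E_-),$$ there exists a cube $W\subset Q$ such that $$\min\{\lambda(E_+\cap W),\lambda(E_-\cap W)\}\ge s\,\lambda(W).$$ For $\tau>0$ let $\sigma(\tau,d)=\sup\{s>0:(\tau,s)\in JS(d)\}$. Then: (i) $(\tau,\sigma(\tau,d))\in JS(d)$ for each $\tau>0$. (ii) $JS(d)=\{(x,y): x>0,\ 0<y\le\sigma(x,d)\}$. (iii) The function $x\mapsto\sigma(x,d)$ is non-decreasing and continuous on $(0,\infty)$ and satisfies $$\varphi(x,d)\le\sigma(x,d)\le\frac{1}{2+\frac1x}\quad\text{for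 all }x>0,$$ where $$\varphi(x,d)=\begin{cases}2^{-d}\,\dfrac{x-x^2}{1+x}, & 0<x\le\sqrt2-1,\\[1ex] 2^{-d}\,(3-2\sqrt2), & x\ge\sqrt2-1.\end{cases}$$ -/

import Mathlib

open MeasureTheory Set

namespace JohnStromberg

/-- A closed cube in `ℝ^d` with sides parallel to the axes: a product of `d` closed bounded
intervals, all of the same length `ℓ > 0`. -/
def IsCube {d : ℕ} (W : Set (Fin d → ℝ)) : Prop :=
  ∃ (a : Fin d → ℝ) (ℓ : ℝ), 0 < ℓ ∧ W = Set.univ.pi fun i => Set.Icc (a i) (a i + ℓ)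

/-- The collection of all cubes in `ℝ^d`. -/
def cubes (d : ℕ) : Set (Set (Fin d → ℝ)) := {W | IsCube W}

/-- Cubes are measurable and have positive finite Lebesgue measure. -/
theorem cubes_admissible {d : ℕ} {W : Set (Fin d → ℝ)} (hW : W ∈ cubes d) :
    MeasurableSet W ∧ 0 < volume W ∧ volume W < ⊤ := by
  obtain ⟨a, l, hl, rfl⟩ := hW
  refine ⟨MeasurableSet.univ_pi fun i => measurableSet_Icc, ?_, ?_⟩
  · rw [volume_pi_pi]
    simpa [Real.volume_Icc] using ENNReal.pow_pos (ENNReal.ofReal_pos.2 hl) d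
  · rw [volume_pi_pi]
    simp [Real.volume_Icc]

/-- `(τ, s)` is a John–Strömberg pair for a collection `𝓔` of subsets of `ℝ^d` (whose members
are Lebesgue measurable with positive finite Lebesgue measure). Lebesgue measurability is
`NullMeasurableSet _ volume`; all sets whose measure is taken are contained in members of `𝓔`,
hence have finite measure, so that real-valued measures can be used. -/
def IsJohnStrombergPair {d : ℕ} (𝓔 : Set (Set (Fin d → ℝ))) (τ s : ℝ) : Prop :=
  0 < τ ∧ 0 < s ∧
    ∀ Q ∈ 𝓔, ∀ Ep Em : Set (Fin d → ℝ),
      NullMeasurableSet Ep volume → NullMeasurableSet Em volume →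
      Ep ⊆ Q → Em ⊆ Q → Disjoint Ep Em →
      τ * volume.real ((Q \ Ep) \ Em) < min (volume.real Ep) (volume.real Em) →
      ∃ W ∈ 𝓔, W ⊆ Q ∧
        s * volume.real W ≤ min (volume.real (Ep ∩ W)) (volume.real (Em ∩ W))

/-- `JS(d)`: the set of all John–Strömberg pairs for the collection of all cubes in `ℝ^d`. -/
def JS (d : ℕ) : Set (ℝ × ℝ) := {p | IsJohnStrombergPair (cubes d) p.1 p.2}

/-- `σ(τ, d) = sup {s > 0 : (τ, s) ∈ JS(d)}`. -/
noncomputable def sigma (τ : ℝ) (d : ℕ) : ℝ := sSup {s : ℝ | 0 < s ∧ (τ, s) ∈ JS d}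

/-- The explicit lower bound; both formulas agree at `x = √2 - 1`. -/
noncomputable def phi (x : ℝ) (d : ℕ) : ℝ :=
  if x ≤ √2 - 1 then (2 : ℝ) ^ (-(d : ℤ)) * ((x - x ^ 2) / (1 + x))
  else (2 : ℝ) ^ (-(d : ℤ)) * (3 - 2 * √2)

end JohnStromberg

/-!
For a cube `Q` with disjoint subsets `E`, `F`, call the rest `G = Q \ (E ∪ F)`.

*Supremum attained.* The strict inequality `τ * |G| < min |E| |F|` survives the passage to compact
subsets of `E` and `F` (`mem_JS_of_isCompact`). Disjoint compact sets are a positive distance apart,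
so cubes with a definite share of both have sides bounded below. Almost optimal cubes therefore
subconverge to an optimal one (`mem_JS_of_forall_lt`).

*Lower bound.* The pair `(τ, 2 ^ (-d) * c)` with `c = τ / (1 + 2 * τ)` is a John–Strömberg pair
(`lower_pair_mem_JS`), and this `c` dominates the stated bound (`phi_le`). If no cube has a share
`2 ^ (-d) * c` of both sets, then one of them, say `E`, has density at most `c` in `Q`. By Lebesgue's
density theorem almost every point of `E` lies in a dyadic cube in which `E` has density
greater than `c`. The parent of the first such cube has density of `E` between `2 ^ (-d) * c` and `c`,
hence density of `F` below `2 ^ (-d) * c`, hence density of `G` at least `1 - 2 * c`. Maximal cubes with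
these properties are disjoint and cover almost all of `E`, so
`|E| ≤ c / (1 - 2 * c) * |G| = τ * |G|`, against the hypothesis.

*Upper bound.* Two slabs of volume `t` at opposite faces of the unit cube force `s ≤ t` as soon as
`τ * (1 - 2 * t) < t` (`le_of_mem_JS`).

*Continuity.* Continuity from the right follows from the strictness of `τ * |G| < min |E| |F|`
(`mem_JS_of_forall_gt`). For continuity from the left, `perturbed_mem_JS` shows that
`(τ, s) ∈ JS d` implies `(τ * (1 - 1 / N), s - 2 ^ d / N) ∈ JS d`: one `N`-th of `G`, cut out by a
finely periodic family of slabs, is moved to one of the two sets. This compensates for the smaller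
parameter, and changes the share of that set in every relevant cube by at most `2 ^ d / N`.
-/

namespace JohnStromberg

open Filter Topology

/-! ### Cubes and compact subsets -/

/-- The closed cube with lowest corner `a` and side `ℓ`. -/
abbrev cube {d : ℕ} (a : Fin d → ℝ) (ℓ : ℝ) : Set (Fin d → ℝ) :=
  Set.univ.pi fun i => Set.Icc (a i) (a i + ℓ)

section Cubes

variable {d : ℕ}

theorem cube_mem_cubes (a : Fin d → ℝ) {ℓ : ℝ} (hℓ : 0 < ℓ) : cube a ℓ ∈ cubes d :=
  ⟨a, ℓ, hℓ, rfl⟩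

theorem volume_real_cube (a : Fin d → ℝ) {ℓ : ℝ} (hℓ : 0 ≤ ℓ) :
    volume.real (cube a ℓ) = ℓ ^ d := by
  rw [Measure.real, volume_pi_pi]
  simp [ENNReal.toReal_ofReal hℓ]

theorem measurableSet_cube (a : Fin d → ℝ) (ℓ : ℝ) : MeasurableSet (cube a ℓ) :=
  MeasurableSet.univ_pi fun _ => measurableSet_Icc

theorem volume_cube_ne_top (a : Fin d → ℝ) (ℓ : ℝ) : volume (cube a ℓ) ≠ ⊤ := by
  rw [volume_pi_pi]
  simp

theorem isCompact_cube (a : Fin d → ℝ) (ℓ : ℝ) : IsCompact (cube a ℓ) :=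
  isCompact_univ_pi fun _ => isCompact_Icc

theorem cube_subset_cube_iff {a b : Fin d → ℝ} {ℓ m : ℝ} (hℓ : 0 ≤ ℓ) :
    cube a ℓ ⊆ cube b m ↔ ∀ i, b i ≤ a i ∧ a i + ℓ ≤ b i + m := by
  constructor
  · intro h i
    have h1 := h (show a ∈ cube a ℓ from fun j _ => ⟨le_rfl, by linarith⟩) i trivial
    have h2 := h (show (fun j => a j + ℓ) ∈ cube a ℓ from
      fun j _ => ⟨by dsimp; linarith, le_rfl⟩) i trivial
    exact ⟨h1.1, h2.2⟩
  · intro h x hx i _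
    have := hx i trivial
    exact ⟨(h i).1.trans this.1, this.2.trans (h i).2⟩

theorem dist_le_of_mem_cube {a x y : Fin d → ℝ} {ℓ : ℝ} (hℓ : 0 ≤ ℓ) (hx : x ∈ cube a ℓ)
    (hy : y ∈ cube a ℓ) : dist x y ≤ ℓ := by
  refine (dist_pi_le_iff hℓ).2 fun i => ?_
  have h1 := hx i trivial
  have h2 := hy i trivial
  rw [Real.dist_eq, abs_le]
  constructor <;> linarith [h1.1, h1.2, h2.1, h2.2]

theorem measureReal_sdiff_sdiff {Q E F : Set (Fin d → ℝ)} (hQ : volume Q ≠ ⊤)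
    (hE : NullMeasurableSet E volume) (hF : NullMeasurableSet F volume) (hEQ : E ⊆ Q)
    (hFQ : F ⊆ Q) (hEF : Disjoint E F) :
    volume.real ((Q \ E) \ F) = volume.real Q - volume.real E - volume.real F := by
  have h1 : volume.real (Q ∩ E) + volume.real (Q \ E) = volume.real Q :=
    measureReal_inter_add_sdiff₀ hE hQ
  have h2 : volume.real ((Q \ E) ∩ F) + volume.real ((Q \ E) \ F) = volume.real (Q \ E) :=
    measureReal_inter_add_sdiff₀ hF (measure_ne_top_of_subset sdiff_subset hQ)
  rw [inter_eq_right.2 hEQ] at h1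
  rw [inter_eq_right.2 (subset_sdiff.2 ⟨hFQ, hEF.symm⟩)] at h2
  linarith

theorem exists_isCompact_subset_lt {E : Set (Fin d → ℝ)} (hE : NullMeasurableSet E volume)
    (hfin : volume E ≠ ⊤) {ε : ℝ} (hε : 0 < ε) :
    ∃ K ⊆ E, IsCompact K ∧ volume.real E < volume.real K + ε := by
  obtain ⟨t, htE, htm, hte⟩ := hE.exists_measurable_subset_ae_eq
  have ht : volume t = volume E := measure_congr hte
  obtain ⟨K, hKt, hK, hlt⟩ := htm.exists_isCompact_lt_add (ht ▸ hfin)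
    (ENNReal.ofReal_pos.2 hε).ne'
  refine ⟨K, hKt.trans htE, hK, ?_⟩
  rw [ht] at hlt
  have := (ENNReal.toReal_lt_toReal hfin
    (ENNReal.add_ne_top.2 ⟨hK.measure_ne_top, ENNReal.ofReal_ne_top⟩)).2 hlt
  rwa [ENNReal.toReal_add hK.measure_ne_top ENNReal.ofReal_ne_top,
    ENNReal.toReal_ofReal hε.le] at this

/-- The hypothesis in the definition of a John–Strömberg pair is an open condition, so it
survives the passage to suitable compact subsets. -/
theorem exists_isCompact_pair {Q E F : Set (Fin d → ℝ)} (hQ : volume Q ≠ ⊤)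
    (hE : NullMeasurableSet E volume) (hF : NullMeasurableSet F volume) (hEQ : E ⊆ Q)
    (hFQ : F ⊆ Q) (hEF : Disjoint E F) {τ : ℝ} (hτ : 0 < τ)
    (h : τ * volume.real ((Q \ E) \ F) < min (volume.real E) (volume.real F)) :
    ∃ K ⊆ E, ∃ L ⊆ F, IsCompact K ∧ IsCompact L ∧
      τ * volume.real ((Q \ K) \ L) < min (volume.real K) (volume.real L) := by
  set g := min (volume.real E) (volume.real F) - τ * volume.real ((Q \ E) \ F) with hg
  have hgpos : 0 < g := by linarith
  -- Two losses of `ε` cost at most `(2 * τ + 1) * ε < g`.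
  set ε := g / (2 * τ + 2) with hε
  have hεpos : 0 < ε := by positivity
  have hεg : (2 * τ + 2) * ε = g := by rw [hε]; field_simp
  obtain ⟨K, hKE, hK, hK'⟩ := exists_isCompact_subset_lt hE
    (measure_ne_top_of_subset hEQ hQ) hεpos
  obtain ⟨L, hLF, hL, hL'⟩ := exists_isCompact_subset_lt hF
    (measure_ne_top_of_subset hFQ hQ) hεpos
  refine ⟨K, hKE, L, hLF, hK, hL, ?_⟩
  rw [measureReal_sdiff_sdiff hQ hE hF hEQ hFQ hEF] at hg
  rw [measureReal_sdiff_sdiff hQ hK.measurableSet.nullMeasurableSet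
    hL.measurableSet.nullMeasurableSet (hKE.trans hEQ) (hLF.trans hFQ) (hEF.mono hKE hLF)]
  have h1 := min_le_left (volume.real E) (volume.real F)
  have h2 := min_le_right (volume.real E) (volume.real F)
  have h3 : τ * (volume.real E - volume.real K + (volume.real F - volume.real L)) ≤
      τ * (2 * ε) := by
    gcongr; linarith
  rw [lt_min_iff]
  constructor <;> nlinarith

theorem exists_pos_lt_dist {K L : Set (Fin d → ℝ)} (hK : IsCompact K) (hL : IsCompact L)
    (hKL : Disjoint K L) : ∃ δ > 0, ∀ x ∈ K, ∀ y ∈ L, δ < dist x y := by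
  obtain ⟨δ, hδ, h⟩ := hKL.exists_cthickenings hK hL.isClosed
  refine ⟨δ, hδ, fun x hx y hy => ?_⟩
  by_contra! hxy
  exact disjoint_left.1 h (Metric.mem_cthickening_of_dist_le x x δ K hx (by simpa using hδ.le))
    (Metric.mem_cthickening_of_dist_le x y δ L hy hxy)

/-- A cube with a positive share of two separated sets cannot be small. -/
theorem lt_side_of_le_min {K L : Set (Fin d → ℝ)} {δ s ℓ : ℝ} {a : Fin d → ℝ} (hℓ : 0 < ℓ)
    (hs : 0 < s) (hKL : ∀ x ∈ K, ∀ y ∈ L, δ < dist x y)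
    (h : s * volume.real (cube a ℓ) ≤
      min (volume.real (K ∩ cube a ℓ)) (volume.real (L ∩ cube a ℓ))) : δ < ℓ := by
  have hpos : 0 < s * volume.real (cube a ℓ) := by
    rw [volume_real_cube a hℓ.le]; positivity
  rw [le_min_iff] at h
  obtain ⟨x, hxK, hx⟩ := nonempty_of_measureReal_ne_zero (hpos.trans_le h.1).ne'
  obtain ⟨y, hyL, hy⟩ := nonempty_of_measureReal_ne_zero (hpos.trans_le h.2).ne'
  exact (hKL x hxK y hyL).trans_le (dist_le_of_mem_cube hℓ.le hx hy)

end Cubes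

/-! ### Monotonicity and attainment of the supremum -/

section Pairs

variable {d : ℕ}

theorem JS_mono_left {τ τ' s : ℝ} (h : (τ, s) ∈ JS d) (hτ : τ ≤ τ') : (τ', s) ∈ JS d := by
  refine ⟨h.1.trans_le hτ, h.2.1, fun Q hQ E F hE hF hEQ hFQ hEF hlt => ?_⟩
  refine h.2.2 Q hQ E F hE hF hEQ hFQ hEF (lt_of_le_of_lt ?_ hlt)
  dsimp only
  gcongr

theorem JS_anti_right {τ s s' : ℝ} (h : (τ, s) ∈ JS d) (hs' : 0 < s') (hs : s' ≤ s) :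
    (τ, s') ∈ JS d := by
  refine ⟨h.1, hs', fun Q hQ E F hE hF hEQ hFQ hEF hlt => ?_⟩
  obtain ⟨W, hW, hWQ, hle⟩ := h.2.2 Q hQ E F hE hF hEQ hFQ hEF hlt
  refine ⟨W, hW, hWQ, le_trans ?_ hle⟩
  dsimp only
  gcongr

/-- It is enough to test the defining property on compact sets, which have a positive distance
from each other. -/
theorem mem_JS_of_isCompact {τ s : ℝ} (hτ : 0 < τ) (hs : 0 < s)
    (h : ∀ (a : Fin d → ℝ) (ℓ : ℝ), 0 < ℓ → ∀ K L : Set (Fin d → ℝ), IsCompact K →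
      IsCompact L → K ⊆ cube a ℓ → L ⊆ cube a ℓ → Disjoint K L →
      τ * volume.real ((cube a ℓ \ K) \ L) < min (volume.real K) (volume.real L) →
      ∃ (b : Fin d → ℝ) (m : ℝ), 0 < m ∧ cube b m ⊆ cube a ℓ ∧
        s * volume.real (cube b m) ≤
          min (volume.real (K ∩ cube b m)) (volume.real (L ∩ cube b m))) :
    (τ, s) ∈ JS d := by
  refine ⟨hτ, hs, ?_⟩
  rintro Q ⟨a, ℓ, hℓ, rfl⟩ E F hE hF hEQ hFQ hEF hlt
  obtain ⟨K, hKE, L, hLF, hK, hL, hKL⟩ := exists_isCompact_pair (volume_cube_ne_top a ℓ)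
    hE hF hEQ hFQ hEF hτ hlt
  obtain ⟨b, m, hm, hb, hle⟩ := h a ℓ hℓ K L hK hL (hKE.trans hEQ) (hLF.trans hFQ)
    (hEF.mono hKE hLF) hKL
  refine ⟨cube b m, cube_mem_cubes b hm, hb, hle.trans (min_le_min ?_ ?_)⟩
  · exact measureReal_mono (inter_subset_inter_left _ hKE)
      (measure_ne_top_of_subset inter_subset_right (volume_cube_ne_top b m))
  · exact measureReal_mono (inter_subset_inter_left _ hLF)
      (measure_ne_top_of_subset inter_subset_right (volume_cube_ne_top b m))

theorem exists_cube_of_mem_JS {τ s : ℝ} (h : (τ, s) ∈ JS d) {a : Fin d → ℝ} {ℓ : ℝ}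
    (hℓ : 0 < ℓ) {E F : Set (Fin d → ℝ)} (hE : NullMeasurableSet E volume)
    (hF : NullMeasurableSet F volume) (hEQ : E ⊆ cube a ℓ) (hFQ : F ⊆ cube a ℓ)
    (hEF : Disjoint E F)
    (hlt : τ * volume.real ((cube a ℓ \ E) \ F) < min (volume.real E) (volume.real F)) :
    ∃ (b : Fin d → ℝ) (m : ℝ), 0 < m ∧ cube b m ⊆ cube a ℓ ∧
      s * volume.real (cube b m) ≤
        min (volume.real (E ∩ cube b m)) (volume.real (F ∩ cube b m)) := by
  obtain ⟨W, ⟨b, m, hm, rfl⟩, hW, hle⟩ :=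
    h.2.2 _ (cube_mem_cubes a hℓ) E F hE hF hEQ hFQ hEF hlt
  exact ⟨b, m, hm, hW, hle⟩

/-- Upper semicontinuity of `W ↦ |K ∩ W|`: the excess of a nearby cube over `W` is controlled by
the volume of a concentric shell. -/
theorem measureReal_inter_cube_le (K : Set (Fin d → ℝ)) {a b : Fin d → ℝ} {ℓ m η : ℝ}
    (hℓ : 0 ≤ ℓ) (hη : 0 ≤ η) (ha : ∀ i, a i - η ≤ b i) (hb : ∀ i, b i + m ≤ a i + ℓ + η) :
    volume.real (K ∩ cube b m) ≤
      volume.real (K ∩ cube a ℓ) + ((ℓ + 2 * η) ^ d - ℓ ^ d) := by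
  have hsub : cube a ℓ ⊆ cube (fun i => a i - η) (ℓ + 2 * η) :=
    (cube_subset_cube_iff hℓ).2 fun i => ⟨by linarith, by linarith⟩
  have hsub' : cube b m ⊆ cube (fun i => a i - η) (ℓ + 2 * η) := by
    intro x hx i _
    have := hx i trivial
    exact ⟨(ha i).trans this.1, by linarith [this.2, hb i]⟩
  have hfin := volume_cube_ne_top (fun i => a i - η) (ℓ + 2 * η)
  have hshell : volume.real (cube (fun i => a i - η) (ℓ + 2 * η) \ cube a ℓ) =
      (ℓ + 2 * η) ^ d - ℓ ^ d := by
    rw [measureReal_sdiff hsub (measurableSet_cube _ _) hfin,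
      volume_real_cube _ (by linarith), volume_real_cube _ hℓ]
  calc volume.real (K ∩ cube b m)
      ≤ volume.real ((K ∩ cube a ℓ) ∪
          (cube (fun i => a i - η) (ℓ + 2 * η) \ cube a ℓ)) := by
        refine measureReal_mono ?_ ?_
        · rintro x ⟨hxK, hx⟩
          by_cases hxa : x ∈ cube a ℓ
          · exact Or.inl ⟨hxK, hxa⟩
          · exact Or.inr ⟨hsub' hx, hxa⟩
        · exact measure_ne_top_of_subset
            (union_subset (inter_subset_right.trans hsub) sdiff_subset) hfin
    _ ≤ _ := measureReal_union_le _ _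
    _ = _ := by rw [hshell]

/-- The supremum is attained. For compact `K`, `L` at positive distance, cubes that have a share
`s' < s` close to `s` of both have sides bounded below, so a subsequence converges to a genuine cube. -/
theorem mem_JS_of_forall_lt (hd : 0 < d) {τ s : ℝ} (hs : 0 < s)
    (h : ∀ s', 0 < s' → s' < s → (τ, s') ∈ JS d) : (τ, s) ∈ JS d := by
  have hτ : 0 < τ := (h (s / 2) (by linarith) (by linarith)).1
  refine mem_JS_of_isCompact hτ hs fun a ℓ hℓ K L hK hL hKQ hLQ hKL hlt => ?_
  obtain ⟨δ, hδ, hdist⟩ := exists_pos_lt_dist hK hL hKL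
  obtain ⟨u, hu_mono, hu_mem, hu⟩ := exists_seq_strictMono_tendsto' hs
  choose b m hm hsub hle using fun n => exists_cube_of_mem_JS (h (u n) (hu_mem n).1 (hu_mem n).2)
    hℓ hK.measurableSet.nullMeasurableSet hL.measurableSet.nullMeasurableSet hKQ hLQ hKL hlt
  have hmδ : ∀ n, δ < m n := fun n => lt_side_of_le_min (hm n) (hu_mem n).1 hdist (hle n)
  have hbox : ∀ n i, a i ≤ b n i ∧ b n i + m n ≤ a i + ℓ := fun n =>
    (cube_subset_cube_iff (hm n).le).1 (hsub n)
  have hmem : ∀ n, (b n, m n) ∈ cube a ℓ ×ˢ Icc δ ℓ := by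
    refine fun n => ⟨fun i _ => ⟨(hbox n i).1, by linarith [(hbox n i).2, hm n]⟩,
      (hmδ n).le, ?_⟩
    have := hbox n ⟨0, hd⟩
    linarith
  obtain ⟨⟨c, r⟩, hcr, φ, hφ, hlim⟩ :=
    ((isCompact_cube a ℓ).prod isCompact_Icc).tendsto_subseq hmem
  have hr : 0 < r := hδ.trans_le hcr.2.1
  have hlimb : Tendsto (fun n => b (φ n)) atTop (𝓝 c) := (continuous_fst.tendsto _).comp hlim
  have hlimm : Tendsto (fun n => m (φ n)) atTop (𝓝 r) := (continuous_snd.tendsto _).comp hlim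
  have hlimu : Tendsto (fun n => u (φ n)) atTop (𝓝 s) := hu.comp hφ.tendsto_atTop
  have hlimbi : ∀ i, Tendsto (fun n => b (φ n) i) atTop (𝓝 (c i)) := fun i =>
    (continuous_apply i).continuousAt.tendsto.comp hlimb
  set η : ℕ → ℝ := fun n => dist (b (φ n)) c + |m (φ n) - r| with hη
  have hlimη : Tendsto η atTop (𝓝 0) := by
    have h1 := tendsto_iff_dist_tendsto_zero.1 hlimb
    have h2 := tendsto_iff_dist_tendsto_zero.1 hlimm
    simpa [hη, Real.dist_eq] using h1.add h2
  refine ⟨c, r, hr, (cube_subset_cube_iff hr.le).2 fun i => ⟨?_, ?_⟩, ?_⟩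
  · exact ge_of_tendsto' (hlimbi i) fun n => (hbox _ i).1
  · exact le_of_tendsto' ((hlimbi i).add hlimm) fun n => (hbox _ i).2
  have key : ∀ A : Set (Fin d → ℝ),
      (∀ n, u n * volume.real (cube (b n) (m n)) ≤ volume.real (A ∩ cube (b n) (m n))) →
      s * volume.real (cube c r) ≤ volume.real (A ∩ cube c r) := by
    intro A hA
    have h1 : ∀ n, u (φ n) * m (φ n) ^ d ≤
        volume.real (A ∩ cube c r) + ((r + 2 * η n) ^ d - r ^ d) := by
      intro n
      rw [← volume_real_cube (b (φ n)) (hm _).le]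
      have hη0 : 0 ≤ η n := by positivity
      have hcoord : ∀ i, |b (φ n) i - c i| ≤ dist (b (φ n)) c := fun i => by
        rw [← Real.dist_eq]; exact dist_le_pi_dist _ _ i
      refine (hA _).trans (measureReal_inter_cube_le A hr.le hη0 (fun i => ?_) fun i => ?_)
      · have := neg_abs_le (b (φ n) i - c i)
        have := hcoord i
        have := abs_nonneg (m (φ n) - r)
        simp only [hη]; linarith
      · have := le_abs_self (b (φ n) i - c i)
        have := hcoord i
        have := le_abs_self (m (φ n) - r)
        simp only [hη]; linarith
    have h2 : Tendsto (fun n => volume.real (A ∩ cube c r) + ((r + 2 * η n) ^ d - r ^ d)) atTop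
        (𝓝 (volume.real (A ∩ cube c r) + ((r + 2 * 0) ^ d - r ^ d))) :=
      tendsto_const_nhds.add
        (((tendsto_const_nhds.add (hlimη.const_mul 2)).pow d).sub tendsto_const_nhds)
    have h3 := le_of_tendsto_of_tendsto' (hlimu.mul (hlimm.pow d)) h2 h1
    rw [volume_real_cube c hr.le]
    simpa using h3
  exact le_min (key K fun n => (hle n).trans (min_le_left _ _))
    (key L fun n => (hle n).trans (min_le_right _ _))

end Pairs

/-! ### Dyadic cells and the lower bound -/

section Dyadic

variable {d : ℕ}

/-- The half-open dyadic cell of generation `k` with integer position `j`, in the grid obtained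
from the cube with lowest corner `a` and side `L` by repeated halving. Half-open cells of one
generation partition the whole space; positions outside the initial cube are allowed. -/
def dyadicCell (a : Fin d → ℝ) (L : ℝ) (k : ℕ) (j : Fin d → ℤ) : Set (Fin d → ℝ) :=
  Set.univ.pi fun i => Set.Ico (a i + j i * (L / 2 ^ k)) (a i + j i * (L / 2 ^ k) + L / 2 ^ k)

/-- The position of the dyadic cell of generation `k` which contains `x`. -/
noncomputable def dyadicIndex (a : Fin d → ℝ) (L : ℝ) (k : ℕ) (x : Fin d → ℝ) : Fin d → ℤ :=
  fun i => ⌊(x i - a i) / (L / 2 ^ k)⌋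

theorem mem_dyadicCell_iff {a : Fin d → ℝ} {L : ℝ} (hL : 0 < L) {k : ℕ} {j : Fin d → ℤ}
    {x : Fin d → ℝ} : x ∈ dyadicCell a L k j ↔ dyadicIndex a L k x = j := by
  have hh : 0 < L / 2 ^ k := by positivity
  simp only [dyadicCell, mem_univ_pi, mem_Ico, funext_iff, dyadicIndex, Int.floor_eq_iff,
    le_div_iff₀ hh, div_lt_iff₀ hh]
  refine forall_congr' fun i => and_congr ?_ ?_ <;> constructor <;> intro h <;> linarith

theorem dyadicIndex_eq_ediv (a : Fin d → ℝ) (L : ℝ) (k n : ℕ) (x : Fin d → ℝ) (i : Fin d) :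
    dyadicIndex a L k x i = dyadicIndex a L (k + n) x i / (2 ^ n : ℕ) := by
  rw [dyadicIndex, dyadicIndex, ← Int.floor_div_natCast]
  congr 1
  push_cast
  rw [pow_add, div_div, div_mul_eq_mul_div, mul_div_mul_right _ _ (by positivity)]

theorem dyadicCell_subset {a : Fin d → ℝ} {L : ℝ} (hL : 0 < L) {k k' : ℕ} (hk : k' ≤ k)
    (x : Fin d → ℝ) : dyadicCell a L k (dyadicIndex a L k x) ⊆
      dyadicCell a L k' (dyadicIndex a L k' x) := by
  intro y hy
  rw [mem_dyadicCell_iff hL] at hy ⊢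
  obtain ⟨n, rfl⟩ := Nat.exists_eq_add_of_le hk
  funext i
  rw [dyadicIndex_eq_ediv a L k' n y, dyadicIndex_eq_ediv a L k' n x, hy]

theorem measurableSet_dyadicCell (a : Fin d → ℝ) (L : ℝ) (k : ℕ) (j : Fin d → ℤ) :
    MeasurableSet (dyadicCell a L k j) :=
  MeasurableSet.univ_pi fun _ => measurableSet_Ico

theorem dyadicCell_ae_eq_cube (a : Fin d → ℝ) (L : ℝ) (k : ℕ) (j : Fin d → ℤ) :
    dyadicCell a L k j =ᵐ[volume] cube (fun i => a i + j i * (L / 2 ^ k)) (L / 2 ^ k) := by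
  rw [cube, pi_univ_Icc]
  exact Measure.univ_pi_Ico_ae_eq_Icc

theorem measureReal_inter_dyadicCell (A : Set (Fin d → ℝ)) (a : Fin d → ℝ) (L : ℝ) (k : ℕ)
    (j : Fin d → ℤ) : volume.real (A ∩ dyadicCell a L k j) =
      volume.real (A ∩ cube (fun i => a i + j i * (L / 2 ^ k)) (L / 2 ^ k)) :=
  measureReal_congr ((ae_eq_refl A).inter (dyadicCell_ae_eq_cube a L k j))

/-- Almost every point of `E` lies in dyadic cells, of some generation, in which `E` has density
greater than a given `c < 1`: closed dyadic cubes are balls for the supremum distance, so this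
is Lebesgue's density theorem. -/
theorem ae_exists_lt_measureReal_inter_dyadicCell (E : Set (Fin d → ℝ)) (a : Fin d → ℝ) {L : ℝ}
    (hL : 0 < L) {c : ℝ} (hc : 0 < c) (hc1 : c < 1) :
    ∀ᵐ x ∂(volume.restrict E), ∃ k : ℕ, c * (L / 2 ^ k) ^ d <
      volume.real (E ∩ dyadicCell a L k (dyadicIndex a L k x)) := by
  filter_upwards [IsUnifLocDoublingMeasure.ae_tendsto_measure_inter_div volume E 1] with x hx
  set corner : ℕ → Fin d → ℝ := fun k i => a i + dyadicIndex a L k x i * (L / 2 ^ k)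
    with hcorner
  set w : ℕ → Fin d → ℝ := fun k i => corner k i + L / 2 ^ k / 2 with hw
  have hball : ∀ k, Metric.closedBall (w k) (L / 2 ^ k / 2) = cube (corner k) (L / 2 ^ k) := by
    intro k
    rw [closedBall_pi _ (by positivity), cube]
    congr 1
    funext i
    rw [Real.closedBall_eq_Icc]
    congr 1 <;> simp only [hw] <;> ring
  have hδ : Tendsto (fun k : ℕ => L / 2 ^ k / 2) atTop (𝓝[>] 0) := by
    refine tendsto_nhdsWithin_iff.2 ⟨?_, Eventually.of_forall fun k => ?_⟩
    · have := ((tendsto_pow_atTop_nhds_zero_of_lt_one (r := (1 / 2 : ℝ)) (by norm_num)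
        (by norm_num)).const_mul L).div_const 2
      simpa [div_eq_mul_inv] using this
    · show 0 < L / 2 ^ k / 2
      positivity
  have hmem : ∀ᶠ k in atTop, x ∈ Metric.closedBall (w k) (1 * (L / 2 ^ k / 2)) := by
    refine Eventually.of_forall fun k => ?_
    rw [one_mul, hball]
    have : x ∈ dyadicCell a L k (dyadicIndex a L k x) := (mem_dyadicCell_iff hL).2 rfl
    exact fun i hi => Ico_subset_Icc_self (this i hi)
  have hlim := hx w (fun k => L / 2 ^ k / 2) hδ hmem
  have hc' : ENNReal.ofReal c < 1 := by
    rw [← ENNReal.ofReal_one]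
    exact (ENNReal.ofReal_lt_ofReal_iff one_pos).2 hc1
  obtain ⟨k, hk⟩ := (hlim.eventually (lt_mem_nhds hc')).exists
  refine ⟨k, ?_⟩
  rw [hball] at hk
  have hlt := ENNReal.mul_lt_of_lt_div hk
  rw [measureReal_inter_dyadicCell, ← volume_real_cube (corner k) (by positivity)]
  have := (ENNReal.toReal_lt_toReal
    (ENNReal.mul_ne_top ENNReal.ofReal_ne_top (volume_cube_ne_top _ _))
    (measure_ne_top_of_subset inter_subset_right (volume_cube_ne_top _ _))).2 hlt
  rwa [ENNReal.toReal_mul, ENNReal.toReal_ofReal hc.le] at this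

/-- A dyadic cell is balanced for `E` at level `c` if the density of `E` in it is at most `c`
and at least `c / 2 ^ d`. The parent of a first-time dense cell is balanced. -/
def IsBalanced (E : Set (Fin d → ℝ)) (c : ℝ) (a : Fin d → ℝ) (L : ℝ) (k : ℕ)
    (j : Fin d → ℤ) : Prop :=
  volume.real (E ∩ dyadicCell a L k j) ≤ c * (L / 2 ^ k) ^ d ∧
    c / 2 ^ d * (L / 2 ^ k) ^ d ≤ volume.real (E ∩ dyadicCell a L k j)

/-- The maximal balanced cells contained in the initial cube. -/
def maximalBalanced (E : Set (Fin d → ℝ)) (c : ℝ) (a : Fin d → ℝ) (L : ℝ) :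
    Set (ℕ × (Fin d → ℤ)) :=
  {p | dyadicCell a L p.1 p.2 ⊆ dyadicCell a L 0 0 ∧ IsBalanced E c a L p.1 p.2 ∧
    ∀ k' < p.1, ∀ j', dyadicCell a L p.1 p.2 ⊆ dyadicCell a L k' j' →
      ¬ IsBalanced E c a L k' j'}

theorem pairwiseDisjoint_maximalBalanced (E : Set (Fin d → ℝ)) (c : ℝ) (a : Fin d → ℝ) {L : ℝ}
    (hL : 0 < L) : (maximalBalanced E c a L).PairwiseDisjoint
      fun p => dyadicCell a L p.1 p.2 := by
  have key : ∀ p ∈ maximalBalanced E c a L, ∀ q ∈ maximalBalanced E c a L, ∀ x,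
      x ∈ dyadicCell a L p.1 p.2 → x ∈ dyadicCell a L q.1 q.2 → p.1 ≤ q.1 := by
    intro p hp q hq x hxp hxq
    by_contra! hlt
    refine hp.2.2 q.1 hlt q.2 ?_ hq.2.1
    rw [← (mem_dyadicCell_iff hL).1 hxp, ← (mem_dyadicCell_iff hL).1 hxq]
    exact dyadicCell_subset hL hlt.le x
  intro p hp q hq hpq
  refine disjoint_left.2 fun x hxp hxq => hpq ?_
  have h1 : p.1 = q.1 := le_antisymm (key p hp q hq x hxp hxq) (key q hq p hp x hxq hxp)
  refine Prod.ext h1 ?_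
  rw [← (mem_dyadicCell_iff hL).1 hxp, ← (mem_dyadicCell_iff hL).1 hxq, h1]

/-- If `E` has density at most `c` in the initial cube, then the maximal balanced cells cover
almost all of `E`: a first cell of density greater than `c` has a balanced parent. -/
theorem ae_mem_maximalBalanced {E : Set (Fin d → ℝ)} {a : Fin d → ℝ} {L : ℝ} (hL : 0 < L)
    (hE : NullMeasurableSet E volume) (hEQ : E ⊆ cube a L) {c : ℝ} (hc : 0 < c) (hc1 : c < 1)
    (hsmall : volume.real E ≤ c * L ^ d) :
    ∀ᵐ x ∂(volume.restrict E), x ∈ ⋃ p ∈ maximalBalanced E c a L, dyadicCell a L p.1 p.2 := by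
  have hfin : volume E ≠ ⊤ := measure_ne_top_of_subset hEQ (volume_cube_ne_top a L)
  have hQ : ∀ᵐ x ∂(volume.restrict E), x ∈ dyadicCell a L 0 0 := by
    have h1 : ∀ᵐ x ∂(volume : Measure (Fin d → ℝ)), x ∈ dyadicCell a L 0 0 ↔ x ∈ cube a L := by
      have := dyadicCell_ae_eq_cube a L 0 0
      simp only [Pi.zero_apply, Int.cast_zero, zero_mul, add_zero, pow_zero, div_one] at this
      exact this.mem_iff
    filter_upwards [ae_restrict_of_ae h1, ae_restrict_mem₀ hE] with x hx hxE
    exact hx.2 (hEQ hxE)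
  filter_upwards [hQ, ae_exists_lt_measureReal_inter_dyadicCell E a hL hc hc1] with x hxQ hx
  classical
  have hbal : ∃ k, IsBalanced E c a L k (dyadicIndex a L k x) := by
    have hk := Nat.find_spec hx
    have hmin := fun m => @Nat.find_min _ _ hx m
    set k := Nat.find hx
    rcases k with _ | k
    · refine absurd hk (not_lt.2 ?_)
      simpa using (measureReal_mono inter_subset_left hfin).trans hsmall
    · refine ⟨k, not_lt.1 (hmin k k.lt_succ_self), ?_⟩
      have h1 : c / 2 ^ d * (L / 2 ^ k) ^ d = c * (L / 2 ^ (k + 1)) ^ d := by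
        rw [pow_succ, ← div_div, div_pow (L / 2 ^ k)]; ring
      rw [h1]
      exact hk.le.trans (measureReal_mono
        (inter_subset_inter_right _ (dyadicCell_subset hL k.le_succ x))
        (measure_ne_top_of_subset inter_subset_left hfin))
  refine mem_biUnion (x := (Nat.find hbal, dyadicIndex a L (Nat.find hbal) x)) ?_
    ((mem_dyadicCell_iff hL).2 rfl)
  refine ⟨?_, Nat.find_spec hbal, fun k' hk' j' hsub => ?_⟩
  · have := dyadicCell_subset (a := a) hL (Nat.zero_le (Nat.find hbal)) x
    rwa [(mem_dyadicCell_iff hL).1 hxQ] at this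
  · rw [← (mem_dyadicCell_iff hL).1 (hsub ((mem_dyadicCell_iff hL).2 rfl))]
    exact Nat.find_min hbal hk'

/-- A balanced cell in which `F` has density at most `c / 2 ^ d` is mostly filled by the complement
of the two sets. -/
theorem IsBalanced.mul_measureReal_le {E F : Set (Fin d → ℝ)} {a : Fin d → ℝ} {L : ℝ}
    (hL : 0 < L) (hE : NullMeasurableSet E volume) (hF : NullMeasurableSet F volume)
    (hEF : Disjoint E F) {c : ℝ} (hc : 0 < c)
    (hc1 : c < 1 / 2)
    (hno : ∀ (b : Fin d → ℝ) (m : ℝ), 0 < m → cube b m ⊆ cube a L →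
      c / 2 ^ d * m ^ d ≤ volume.real (E ∩ cube b m) →
      volume.real (F ∩ cube b m) ≤ c / 2 ^ d * m ^ d)
    {k : ℕ} {j : Fin d → ℤ} (hsub : dyadicCell a L k j ⊆ dyadicCell a L 0 0)
    (hbal : IsBalanced E c a L k j) :
    (1 - 2 * c) * volume.real (E ∩ dyadicCell a L k j) ≤
      c * volume.real (((cube a L \ E) \ F) ∩ dyadicCell a L k j) := by
  obtain ⟨hle, hge⟩ := hbal
  rw [measureReal_inter_dyadicCell] at hle hge ⊢
  rw [measureReal_inter_dyadicCell]
  have hm : 0 < L / 2 ^ k := by positivity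
  have hbQ : cube (fun i => a i + j i * (L / 2 ^ k)) (L / 2 ^ k) ⊆ cube a L := by
    have hne : dyadicCell a L k j ≠ ∅ := nonempty_iff_ne_empty.1
      ⟨fun i => a i + j i * (L / 2 ^ k), fun i _ => ⟨le_rfl, by dsimp only; linarith⟩⟩
    refine (cube_subset_cube_iff hm.le).2 fun i => ?_
    have h1 := (pi_subset_pi_iff.1 hsub).resolve_right hne i trivial
    have h2 := (Ico_subset_Ico_iff (by linarith)).1 h1
    simpa using h2
  generalize L / 2 ^ k = m at *
  generalize (fun i => a i + (j i : ℝ) * m) = b at *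
  have hFb := hno b m hm hbQ hge
  have hGeq : ((cube a L \ E) \ F) ∩ cube b m =
      (cube b m \ (E ∩ cube b m)) \ (F ∩ cube b m) := by
    ext x
    constructor
    · rintro ⟨⟨⟨-, hxE⟩, hxF⟩, hx⟩
      exact ⟨⟨hx, fun h => hxE h.1⟩, fun h => hxF h.1⟩
    · rintro ⟨⟨hx, hxE⟩, hxF⟩
      exact ⟨⟨⟨hbQ hx, fun h => hxE ⟨h, hx⟩⟩, fun h => hxF ⟨h, hx⟩⟩, hx⟩
  have hsum : volume.real (((cube a L \ E) \ F) ∩ cube b m) =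
      m ^ d - volume.real (E ∩ cube b m) - volume.real (F ∩ cube b m) := by
    rw [hGeq, measureReal_sdiff_sdiff (volume_cube_ne_top b m)
      (hE.inter (measurableSet_cube b m).nullMeasurableSet)
      (hF.inter (measurableSet_cube b m).nullMeasurableSet) inter_subset_right
      inter_subset_right (hEF.mono inter_subset_left inter_subset_left),
      volume_real_cube b hm.le]
  have hpow : c / 2 ^ d * m ^ d ≤ c * m ^ d := by
    gcongr
    exact div_le_self hc.le (one_le_pow₀ one_le_two)
  calc (1 - 2 * c) * volume.real (E ∩ cube b m)
      ≤ (1 - 2 * c) * (c * m ^ d) := by gcongr; linarith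
    _ = c * (m ^ d - c * m ^ d - c * m ^ d) := by ring
    _ ≤ c * volume.real (((cube a L \ E) \ F) ∩ cube b m) := by rw [hsum]; gcongr; linarith

/-- If no subcube has a share at least `c / 2 ^ d` of both sets, then in each maximal balanced
cell the rest outweighs `E` by the factor `(1 - 2 * c) / c`, hence it does so globally. -/
theorem mul_measureReal_le_of_forall_cube {E F : Set (Fin d → ℝ)} {a : Fin d → ℝ} {L : ℝ}
    (hL : 0 < L) (hE : NullMeasurableSet E volume) (hF : NullMeasurableSet F volume)
    (hEQ : E ⊆ cube a L) (hEF : Disjoint E F) {c : ℝ} (hc : 0 < c)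
    (hc1 : c < 1 / 2) (hsmall : volume.real E ≤ c * L ^ d)
    (hno : ∀ (b : Fin d → ℝ) (m : ℝ), 0 < m → cube b m ⊆ cube a L →
      c / 2 ^ d * m ^ d ≤ volume.real (E ∩ cube b m) →
      volume.real (F ∩ cube b m) ≤ c / 2 ^ d * m ^ d) :
    (1 - 2 * c) * volume.real E ≤ c * volume.real ((cube a L \ E) \ F) := by
  have hcell : ∀ p ∈ maximalBalanced E c a L,
      (1 - 2 * c) * volume.real (E ∩ dyadicCell a L p.1 p.2) ≤
        c * volume.real (((cube a L \ E) \ F) ∩ dyadicCell a L p.1 p.2) := fun p hp =>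
    hp.2.1.mul_measureReal_le hL hE hF hEF hc hc1 hno hp.1
  have hfinE : volume E ≠ ⊤ := measure_ne_top_of_subset hEQ (volume_cube_ne_top a L)
  have hfinG : volume ((cube a L \ E) \ F) ≠ ⊤ := measure_ne_top_of_subset
    (sdiff_subset.trans sdiff_subset) (volume_cube_ne_top a L)
  generalize (cube a L \ E) \ F = G at *
  have hdisj := pairwiseDisjoint_maximalBalanced E c a hL
  have hcover := ae_mem_maximalBalanced hL hE hEQ hc (by linarith) hsmall
  generalize maximalBalanced E c a L = S at *
  have hSc : S.Countable := S.to_countable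
  have hmeas : ∀ p ∈ S, MeasurableSet (dyadicCell a L p.1 p.2) := fun p _ =>
    measurableSet_dyadicCell a L p.1 p.2
  have hsum : ENNReal.ofReal (1 - 2 * c) *
        volume.restrict E (⋃ p ∈ S, dyadicCell a L p.1 p.2) ≤
      ENNReal.ofReal c * volume.restrict G (⋃ p ∈ S, dyadicCell a L p.1 p.2) := by
    rw [measure_biUnion hSc hdisj hmeas, measure_biUnion hSc hdisj hmeas,
      ← ENNReal.tsum_mul_left, ← ENNReal.tsum_mul_left]
    refine ENNReal.tsum_le_tsum fun p => ?_
    rw [Measure.restrict_apply (hmeas p p.2), Measure.restrict_apply (hmeas p p.2),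
      inter_comm _ E, inter_comm _ G,
      ← ofReal_measureReal (measure_ne_top_of_subset inter_subset_left hfinE),
      ← ofReal_measureReal (measure_ne_top_of_subset inter_subset_left hfinG),
      ← ENNReal.ofReal_mul (by linarith), ← ENNReal.ofReal_mul hc.le]
    exact ENNReal.ofReal_le_ofReal (hcell p p.2)
  have hEU : volume.restrict E (⋃ p ∈ S, dyadicCell a L p.1 p.2) = volume E := by
    rw [← Measure.restrict_apply_univ E]
    exact measure_congr (eventuallyEq_univ.2 hcover)
  have hGU : volume.restrict G (⋃ p ∈ S, dyadicCell a L p.1 p.2) ≤ volume G := by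
    rw [← Measure.restrict_apply_univ G]
    exact measure_mono (subset_univ _)
  rw [hEU] at hsum
  have hfinal := hsum.trans (mul_le_mul_right hGU _)
  rw [← ofReal_measureReal hfinE, ← ofReal_measureReal hfinG,
    ← ENNReal.ofReal_mul (by linarith), ← ENNReal.ofReal_mul hc.le] at hfinal
  exact (ENNReal.ofReal_le_ofReal_iff (by positivity)).1 hfinal

/-- The lower bound. The constant `c = τ / (1 + 2 * τ)` solves `c = τ * (1 - 2 * c)`. -/
theorem lower_pair_mem_JS {τ : ℝ} (hτ : 0 < τ) :
    (τ, τ / (1 + 2 * τ) / 2 ^ d) ∈ JS d := by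
  set c := τ / (1 + 2 * τ) with hc_def
  have hc : 0 < c := by positivity
  have hc1 : c < 1 / 2 := by rw [hc_def, div_lt_div_iff₀ (by positivity) two_pos]; linarith
  have hcτ : c = τ * (1 - 2 * c) := by rw [hc_def]; field_simp; ring
  refine ⟨hτ, by positivity, ?_⟩
  rintro Q ⟨a, L, hL, rfl⟩ E F hE hF hEQ hFQ hEF hlt
  change τ * volume.real ((cube a L \ E) \ F) < _ at hlt
  change ∃ W ∈ cubes d, _ ∧ c / 2 ^ d * _ ≤ _
  by_contra! hno
  have hno' : ∀ (b : Fin d → ℝ) (m : ℝ), 0 < m → cube b m ⊆ cube a L →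
      volume.real (E ∩ cube b m) < c / 2 ^ d * m ^ d ∨
        volume.real (F ∩ cube b m) < c / 2 ^ d * m ^ d := by
    intro b m hm hb
    have := hno _ (cube_mem_cubes b hm) hb
    rw [volume_real_cube b hm.le] at this
    exact min_lt_iff.1 this
  rw [lt_min_iff] at hlt
  have hpow : c / 2 ^ d * L ^ d ≤ c * L ^ d := by
    gcongr
    exact div_le_self hc.le (one_le_pow₀ one_le_two)
  have hcancel : ∀ {e g : ℝ}, (1 - 2 * c) * e ≤ c * g → e ≤ τ * g := by
    intro e g h
    refine le_of_mul_le_mul_left (h.trans_eq ?_) (by linarith : 0 < 1 - 2 * c)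
    linear_combination g * hcτ
  rcases hno' a L hL subset_rfl with h | h
  · rw [inter_eq_left.2 hEQ] at h
    refine absurd hlt.1 (not_lt.2 (hcancel (mul_measureReal_le_of_forall_cube hL hE hF hEQ hEF hc
      hc1 (h.le.trans hpow) fun b m hm hb hge => ?_)))
    exact ((hno' b m hm hb).resolve_left (not_lt.2 hge)).le
  · rw [inter_eq_left.2 hFQ] at h
    rw [Set.sdiff_sdiff_comm] at hlt
    refine absurd hlt.2 (not_lt.2 (hcancel (mul_measureReal_le_of_forall_cube hL hF hE hFQ
      hEF.symm hc hc1 (h.le.trans hpow) fun b m hm hb hge => ?_)))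
    exact ((hno' b m hm hb).resolve_right (not_lt.2 hge)).le

end Dyadic

/-! ### The upper bound -/

section Upper

variable {d : ℕ}

theorem measureReal_slab (i₀ : Fin d) (a : Fin d → ℝ) {ℓ u v : ℝ} (hℓ : 0 ≤ ℓ) (huv : u ≤ v) :
    volume.real (univ.pi (Function.update (fun i => Icc (a i) (a i + ℓ)) i₀ (Icc u v))) =
      (v - u) * ℓ ^ (d - 1) := by
  have h : ∀ i, volume (Function.update (fun i => Icc (a i) (a i + ℓ)) i₀ (Icc u v) i) =
      Function.update (fun _ => ENNReal.ofReal ℓ) i₀ (ENNReal.ofReal (v - u)) i := by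
    intro i
    rcases eq_or_ne i i₀ with rfl | hi
    · simp
    · simp [hi]
  rw [Measure.real, volume_pi_pi, Finset.prod_congr rfl fun i _ => h i,
    Finset.prod_update_of_mem (Finset.mem_univ i₀), ENNReal.toReal_mul,
    ENNReal.toReal_ofReal (by linarith), Finset.prod_const, ENNReal.toReal_pow,
    ENNReal.toReal_ofReal hℓ, Finset.card_sdiff_of_subset (Finset.subset_univ _)]
  simp

/-- The test configuration for the upper bound: two slabs at opposite faces of the unit cube,
each of volume `t`. A subcube which meets both slabs spans the whole gap of width `1 - 2 * t`
between them, and the full cube is the best choice. -/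
theorem le_of_mem_JS {τ s t : ℝ} (hd : 0 < d) (h : (τ, s) ∈ JS d) (ht : τ * (1 - 2 * t) < t)
    (ht0 : 0 < t) (ht1 : t < 1 / 2) : s ≤ t := by
  set i₀ : Fin d := ⟨0, hd⟩
  have hs : 0 < s := h.2.1
  -- The part of a cube with the coordinate `i₀` in a given interval.
  have hslab : ∀ (b : Fin d → ℝ) (m u v : ℝ), 0 < m → 0 ≤ v - u → b i₀ ≤ u → v ≤ b i₀ + m →
      volume.real {x ∈ cube b m | x i₀ ∈ Icc u v} = (v - u) * m ^ (d - 1) := by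
    intro b m u v hm huv hbu hvb
    rw [← measureReal_slab i₀ b hm.le (by linarith)]
    congr 1
    ext x
    simp only [mem_ofPred_eq, mem_univ_pi]
    constructor
    · rintro ⟨hx, hx₀⟩ i
      rcases eq_or_ne i i₀ with rfl | hi
      · simpa using hx₀
      · simpa [hi] using hx i
    · intro hx
      have hx₀ : x i₀ ∈ Icc u v := by simpa using hx i₀
      refine ⟨fun i => ?_, hx₀⟩
      rcases eq_or_ne i i₀ with rfl | hi
      · exact ⟨hbu.trans hx₀.1, hx₀.2.trans hvb⟩
      · simpa [hi] using hx i
  set Q : Set (Fin d → ℝ) := cube 0 1 with hQ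
  set E : Set (Fin d → ℝ) := {x ∈ Q | x i₀ ∈ Icc 0 t} with hE
  set F : Set (Fin d → ℝ) := {x ∈ Q | x i₀ ∈ Icc (1 - t) 1} with hF
  have hEm : MeasurableSet E := (measurableSet_cube _ _).inter
    (measurable_pi_apply i₀ measurableSet_Icc)
  have hFm : MeasurableSet F := (measurableSet_cube _ _).inter
    (measurable_pi_apply i₀ measurableSet_Icc)
  have hEF : Disjoint E F := disjoint_left.2 fun x hx hx' => by
    linarith [hx.2.2, hx'.2.1]
  have hEv : volume.real E = t := by
    rw [hE, hQ, hslab 0 1 0 t one_pos (by linarith) le_rfl (by simp; linarith)]; simp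
  have hFv : volume.real F = t := by
    rw [hF, hQ, hslab 0 1 (1 - t) 1 one_pos (by linarith) (by simp; linarith) (by simp)]; simp
  obtain ⟨b, m, hm, hbQ, hle⟩ := exists_cube_of_mem_JS h one_pos hEm.nullMeasurableSet
    hFm.nullMeasurableSet (sep_subset _ _) (sep_subset _ _) hEF (by
      rw [measureReal_sdiff_sdiff (volume_cube_ne_top _ _) hEm.nullMeasurableSet
        hFm.nullMeasurableSet (sep_subset _ _) (sep_subset _ _) hEF, hEv, hFv,
        volume_real_cube _ zero_le_one, min_self]
      simp only [one_pow]
      linarith)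
  have hbi := (cube_subset_cube_iff hm.le).1 hbQ i₀
  simp only [Pi.zero_apply, zero_add] at hbi
  rw [volume_real_cube b hm.le, le_min_iff] at hle
  have hpos : 0 < s * m ^ d := by positivity
  obtain ⟨x, hxE, hxb⟩ := nonempty_of_measureReal_ne_zero (hpos.trans_le hle.1).ne'
  obtain ⟨y, hyF, hyb⟩ := nonempty_of_measureReal_ne_zero (hpos.trans_le hle.2).ne'
  have hx1 := (hxb i₀ trivial).1.trans hxE.2.2
  have hy1 := hyF.2.1.trans (hyb i₀ trivial).2
  have hmd : m ^ d = m * m ^ (d - 1) := by rw [← pow_succ', Nat.sub_add_cancel hd]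
  have hpow : 0 < m ^ (d - 1) := by positivity
  have hE1 : volume.real (E ∩ cube b m) ≤ (t - b i₀) * m ^ (d - 1) := by
    rw [← hslab b m (b i₀) t hm (by linarith) le_rfl (by linarith)]
    exact measureReal_mono (fun z hz => ⟨hz.2, (hz.2 i₀ trivial).1, hz.1.2.2⟩)
      (measure_ne_top_of_subset (sep_subset _ _) (volume_cube_ne_top b m))
  have hF1 : volume.real (F ∩ cube b m) ≤ (b i₀ + m - (1 - t)) * m ^ (d - 1) := by
    rw [← hslab b m (1 - t) (b i₀ + m) hm (by linarith) (by linarith) le_rfl]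
    exact measureReal_mono (fun z hz => ⟨hz.2, hz.1.2.1, (hz.2 i₀ trivial).2⟩)
      (measure_ne_top_of_subset (sep_subset _ _) (volume_cube_ne_top b m))
  have hE2 : s * m ≤ t - b i₀ := by
    refine le_of_mul_le_mul_right ?_ hpow
    rw [mul_assoc, ← hmd]; exact hle.1.trans hE1
  have hF2 : s * m ≤ b i₀ + m - (1 - t) := by
    refine le_of_mul_le_mul_right ?_ hpow
    rw [mul_assoc, ← hmd]; exact hle.2.trans hF1
  -- Adding the two bounds gives `(1 - 2 * t) ≤ (1 - 2 * s) * m` with `m ≤ 1`.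
  by_contra! hst
  nlinarith

end Upper

/-! ### Perturbing the first parameter -/

section Perturbation

variable {d : ℕ}

/-- The union of every `N`-th of the parallel slabs of width `w` orthogonal to the coordinate
direction `i₀`, selected by the residue `j` modulo `N`. -/
def slabs (i₀ : Fin d) (w : ℝ) (N : ℕ) (j : ℕ) : Set (Fin d → ℝ) :=
  {x | ⌊x i₀ / w⌋ % (N : ℤ) = j}

theorem measurableSet_slabs (i₀ : Fin d) (w : ℝ) (N j : ℕ) : MeasurableSet (slabs i₀ w N j) := by
  have h : Measurable fun x : Fin d → ℝ => ⌊x i₀ / w⌋ := by fun_prop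
  exact h (t := {n : ℤ | n % (N : ℤ) = j}) trivial

/-- The `N` translates of `slabs i₀ w N j` by multiples of `w` are disjoint, so the slabs
occupy about one `N`-th of each cube that is large compared with their period `N * w`. -/
theorem mul_measureReal_slabs_inter_cube_le (i₀ : Fin d) {w : ℝ} (hw : 0 < w) (N j : ℕ)
    (b : Fin d → ℝ) {m : ℝ} (hm : 0 ≤ m) :
    N * volume.real (slabs i₀ w N j ∩ cube b m) ≤ (m + N * w) ^ d := by
  set A := slabs i₀ w N j ∩ cube b m
  have hA : MeasurableSet A := (measurableSet_slabs i₀ w N j).inter (measurableSet_cube b m)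
  set T : ℕ → Set (Fin d → ℝ) := fun n => (fun x => x + Pi.single i₀ (-(n * w))) ⁻¹' A with hT
  have hTm : ∀ n, MeasurableSet (T n) := fun n => (measurable_add_const _) hA
  have hTv : ∀ n, volume.real (T n) = volume.real A := fun n => by
    simp only [hT, Measure.real, measure_preimage_add_right]
  have hdisj : ((Finset.range N : Finset ℕ) : Set ℕ).PairwiseDisjoint T := by
    intro n hn n' hn' hne
    refine disjoint_left.2 fun x hx hx' => hne ?_
    have hres : ∀ k : ℕ, x ∈ T k → (⌊x i₀ / w⌋ - k) % (N : ℤ) = j := by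
      intro k hk
      have h1 : ⌊(x i₀ + -(k * w)) / w⌋ % (N : ℤ) = j := by simpa [slabs] using hk.1
      have h2 : (x i₀ + -(k * w)) / w = x i₀ / w - k := by field_simp; ring
      rwa [h2, Int.floor_sub_natCast] at h1
    have h3 : (⌊x i₀ / w⌋ - n) ≡ (⌊x i₀ / w⌋ - n') [ZMOD N] := (hres n hx).trans (hres n' hx').symm
    have h4 : (n : ℤ) ≡ n' [ZMOD N] := by
      have := (Int.ModEq.refl ⌊x i₀ / w⌋).sub h3
      simpa using this
    exact (Int.natCast_modEq_iff.1 h4).eq_of_lt_of_lt (by simpa using hn) (by simpa using hn')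
  have hsub : (⋃ n ∈ Finset.range N, T n) ⊆ cube b (m + N * w) := by
    intro x hx i _
    simp only [mem_iUnion, Finset.mem_range] at hx
    obtain ⟨n, hn, hx⟩ := hx
    have h1 : b i ≤ x i + Pi.single (M := fun _ => ℝ) i₀ (-(n * w)) i ∧
      x i + Pi.single (M := fun _ => ℝ) i₀ (-(n * w)) i ≤ b i + m := hx.2 i trivial
    have hn' : (n : ℝ) ≤ N := by exact_mod_cast hn.le
    have hnw : (n : ℝ) * w ≤ N * w := by gcongr
    have hnw0 : 0 ≤ (n : ℝ) * w := by positivity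
    rcases eq_or_ne i i₀ with rfl | hi
    · rw [Pi.single_eq_same] at h1
      constructor <;> linarith [h1.1, h1.2]
    · rw [Pi.single_eq_of_ne hi] at h1
      constructor <;> linarith [h1.1, h1.2]
  have hfin : ∀ n ∈ Finset.range N, volume (T n) ≠ ⊤ := fun n hn =>
    measure_ne_top_of_subset ((subset_biUnion_of_mem (u := T) hn).trans hsub)
      (volume_cube_ne_top _ _)
  calc N * volume.real A = volume.real (⋃ n ∈ Finset.range N, T n) := by
        rw [measureReal_biUnion_finset hdisj (fun n _ => hTm n) hfin]
        simp [hTv]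
    _ ≤ volume.real (cube b (m + N * w)) := measureReal_mono hsub (volume_cube_ne_top _ _)
    _ = (m + N * w) ^ d := volume_real_cube b (by positivity)

/-- A set of finite measure has a subset with at least one `N`-th of its measure whose density
in every cube of side at least `r` is at most `2 ^ d / N`. -/
theorem exists_thin_subset (i₀ : Fin d) {C : Set (Fin d → ℝ)} (hC : MeasurableSet C)
    (hfin : volume C ≠ ⊤) {N : ℕ} (hN : 0 < N) {r : ℝ} (hr : 0 < r) :
    ∃ A ⊆ C, MeasurableSet A ∧ volume.real C ≤ N * volume.real A ∧
      ∀ (b : Fin d → ℝ) (m : ℝ), r ≤ m → N * volume.real (A ∩ cube b m) ≤ 2 ^ d * m ^ d := by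
  have hNr : (0 : ℝ) < N := by exact_mod_cast hN
  have hw : 0 < r / N := by positivity
  have hcover : C ⊆ ⋃ j ∈ Finset.range N, C ∩ slabs i₀ (r / N) N j := by
    intro x hx
    have h0 := Int.emod_nonneg ⌊x i₀ / (r / N)⌋ (by exact_mod_cast hN.ne' : (N : ℤ) ≠ 0)
    have h1 := Int.emod_lt_of_pos ⌊x i₀ / (r / N)⌋ (by exact_mod_cast hN : (0 : ℤ) < N)
    obtain ⟨j, hj⟩ := Int.eq_ofNat_of_zero_le h0
    refine mem_biUnion (x := j) ?_ ⟨hx, hj⟩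
    rw [hj] at h1
    simpa using h1
  have hsum : volume.real C ≤
      ∑ j ∈ Finset.range N, volume.real (C ∩ slabs i₀ (r / N) N j) := by
    refine (measureReal_mono hcover ?_).trans (measureReal_biUnion_finset_le _ _)
    exact measure_ne_top_of_subset (iUnion₂_subset fun _ _ => inter_subset_left) hfin
  obtain ⟨j, -, hj⟩ := Finset.exists_le_of_sum_le (s := Finset.range N)
    (f := fun _ => volume.real C / N) (Finset.nonempty_range_iff.2 hN.ne')
    (by simpa [mul_div_cancel₀ _ hNr.ne'] using hsum)
  refine ⟨C ∩ slabs i₀ (r / N) N j, inter_subset_left,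
    hC.inter (measurableSet_slabs _ _ _ _), ?_, fun b m hm => ?_⟩
  · rwa [div_le_iff₀' hNr] at hj
  · calc N * volume.real (C ∩ slabs i₀ (r / N) N j ∩ cube b m)
        ≤ N * volume.real (slabs i₀ (r / N) N j ∩ cube b m) := by
          gcongr
          · exact measure_ne_top_of_subset inter_subset_right (volume_cube_ne_top _ _)
          · exact inter_subset_right
      _ ≤ (m + N * (r / N)) ^ d :=
          mul_measureReal_slabs_inter_cube_le i₀ hw N j b (hr.le.trans hm)
      _ ≤ (2 * m) ^ d := by
          rw [mul_div_cancel₀ _ hNr.ne']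
          exact pow_le_pow_left₀ (by linarith) (by linarith) d
      _ = 2 ^ d * m ^ d := mul_pow _ _ _

/-- The first parameter can be lowered at a small cost in the second one. A thin part `A` of
the complement is added to one of the two sets. It increases the measure of the smaller set
relative to the complement, it is invisible to small cubes since it is separated from the other
set, and it has small density in large cubes. -/
theorem perturbed_mem_JS (hd : 0 < d) {τ s : ℝ} (h : (τ, s) ∈ JS d) {N : ℕ} (hN : 2 ≤ N)
    (hs : 2 ^ d / (N : ℝ) < s) : (τ * (1 - 1 / N), s - 2 ^ d / N) ∈ JS d := by
  have hτ : 0 < τ := h.1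
  have hs0 : 0 < s := h.2.1
  have hN1 : (1 : ℝ) < N := by exact_mod_cast hN
  have hNinv : 1 / (N : ℝ) < 1 := by rw [div_lt_one (by linarith)]; exact hN1
  refine mem_JS_of_isCompact (mul_pos hτ (by linarith)) (by linarith)
    fun a ℓ hℓ K L hK hL hKQ hLQ hKL hlt => ?_
  have hQ := volume_cube_ne_top a ℓ
  set G := (cube a ℓ \ K) \ L with hG
  have hGQ : G ⊆ cube a ℓ := sdiff_subset.trans sdiff_subset
  have hGm : MeasurableSet G :=
    MeasurableSet.diff (MeasurableSet.diff (measurableSet_cube a ℓ) hK.measurableSet) hL.measurableSet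
  set g := min (volume.real K) (volume.real L) - τ * (1 - 1 / N) * volume.real G with hg
  have hgpos : 0 < g := by linarith
  obtain ⟨C, hCG, hC, hCv⟩ := exists_isCompact_subset_lt hGm.nullMeasurableSet
    (measure_ne_top_of_subset hGQ hQ) (div_pos hgpos hτ)
  have hKC : Disjoint K (L ∪ C) := disjoint_union_right.2
    ⟨hKL, disjoint_right.2 fun x hx => (hCG hx).1.2⟩
  obtain ⟨r, hr, hdist⟩ := exists_pos_lt_dist hK (hL.union hC) hKC
  obtain ⟨A, hAC, hAm, hAv, hA⟩ := exists_thin_subset ⟨0, hd⟩ hC.measurableSet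
    hC.measure_ne_top (by omega : 0 < N) hr
  have hLA : Disjoint L A := disjoint_right.2 fun x hx => (hCG (hAC hx)).2
  have hKLA : Disjoint K (L ∪ A) := hKC.mono_right (union_subset_union_right L hAC)
  have hAQ : A ⊆ cube a ℓ := (hAC.trans hCG).trans hGQ
  have hLAv : volume.real (L ∪ A) = volume.real L + volume.real A :=
    measureReal_union hLA hAm hL.measure_ne_top (measure_ne_top_of_subset hAQ hQ)
  have hKn := hK.measurableSet.nullMeasurableSet (μ := (volume : Measure (Fin d → ℝ)))
  have hLn := hL.measurableSet.nullMeasurableSet (μ := (volume : Measure (Fin d → ℝ)))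
  have hLAn := (hL.measurableSet.union hAm).nullMeasurableSet
    (μ := (volume : Measure (Fin d → ℝ)))
  have hGv := measureReal_sdiff_sdiff hQ hKn hLn hKQ hLQ hKL
  rw [← hG] at hGv
  obtain ⟨b, m, hm, hbQ, hle⟩ := exists_cube_of_mem_JS h hℓ hKn hLAn hKQ
    (union_subset hLQ hAQ) hKLA (by
      rw [measureReal_sdiff_sdiff hQ hKn hLAn hKQ (union_subset hLQ hAQ) hKLA, hLAv]
      have h1 : τ * (volume.real G - volume.real A) < min (volume.real K) (volume.real L) := by
        -- Only the share `1 / N` of the error `g / τ` in the choice of `C` matters.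
        have h2 : volume.real C / N ≤ volume.real A := by
          rw [div_le_iff₀' (by linarith)]; exact hAv
        have h3 : (volume.real G - volume.real C) * (1 / N) ≤ g / τ * (1 / N) := by
          gcongr; linarith
        have h4 : g / τ * (1 / N) < g / τ * 1 := by gcongr
        have h5 : τ * (g / τ) = g := mul_div_cancel₀ _ hτ.ne'
        have h6 : τ * (volume.real G - volume.real A) ≤
            τ * (volume.real G - volume.real C / N) := by gcongr
        have h7 : τ * ((volume.real G - volume.real C) * (1 / N)) < τ * (g / τ) := by
          gcongr; linarith
        have h8 : τ * (volume.real G - volume.real C / N) =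
          τ * (1 - 1 / N) * volume.real G +
            τ * ((volume.real G - volume.real C) * (1 / N)) := by ring
        linarith
      have h2 : min (volume.real K) (volume.real L) ≤
          min (volume.real K) (volume.real L + volume.real A) :=
        min_le_min_left _ (le_add_of_nonneg_right measureReal_nonneg)
      calc _ = τ * (volume.real G - volume.real A) := by rw [hGv]; ring
        _ < _ := h1
        _ ≤ _ := h2)
  have hrm : r < m := lt_side_of_le_min hm hs0
    (fun x hx y hy => hdist x hx y (union_subset_union_right L hAC hy)) hle
  refine ⟨b, m, hm, hbQ, ?_⟩
  rw [volume_real_cube b hm.le] at hle ⊢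
  rw [le_min_iff] at hle ⊢
  have hthin : volume.real (A ∩ cube b m) ≤ 2 ^ d / N * m ^ d := by
    rw [div_mul_eq_mul_div, le_div_iff₀' (by linarith)]
    exact hA b m hrm.le
  have hsplit : volume.real ((L ∪ A) ∩ cube b m) ≤
      volume.real (L ∩ cube b m) + volume.real (A ∩ cube b m) := by
    rw [union_inter_distrib_right]
    exact measureReal_union_le _ _
  have hnonneg : 0 ≤ 2 ^ d / (N : ℝ) * m ^ d := by positivity
  constructor <;> linarith [hle.1, hle.2, sub_mul s (2 ^ d / (N : ℝ)) (m ^ d)]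

end Perturbation

/-! ### The function `σ` -/

section Sigma

variable {d : ℕ}

theorem le_div_of_mem_JS (hd : 0 < d) {τ s : ℝ} (h : (τ, s) ∈ JS d) : s ≤ τ / (1 + 2 * τ) := by
  have hτ : 0 < τ := h.1
  by_contra! hlt
  have hhalf : τ / (1 + 2 * τ) < 1 / 2 := by
    rw [div_lt_div_iff₀ (by positivity) two_pos]; linarith
  obtain ⟨t, ht, ht'⟩ := exists_between (lt_min hlt hhalf)
  rw [lt_min_iff] at ht'
  have ht0 : 0 < t := lt_trans (by positivity) ht
  rw [div_lt_iff₀ (by positivity)] at ht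
  exact absurd (le_of_mem_JS hd h (by linarith) ht0 ht'.2) (not_le.2 ht'.1)

theorem bddAbove_pairs (hd : 0 < d) (τ : ℝ) : BddAbove {s : ℝ | 0 < s ∧ (τ, s) ∈ JS d} :=
  ⟨τ / (1 + 2 * τ), fun _ hs => le_div_of_mem_JS hd hs.2⟩

theorem le_sigma (hd : 0 < d) {τ s : ℝ} (h : (τ, s) ∈ JS d) : s ≤ sigma τ d :=
  le_csSup (bddAbove_pairs hd τ) ⟨h.2.1, h⟩

theorem sigma_pos (hd : 0 < d) {τ : ℝ} (hτ : 0 < τ) : 0 < sigma τ d :=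
  (lower_pair_mem_JS hτ).2.1.trans_le (le_sigma hd (lower_pair_mem_JS hτ))

theorem sigma_mem_JS (hd : 0 < d) {τ : ℝ} (hτ : 0 < τ) : (τ, sigma τ d) ∈ JS d := by
  refine mem_JS_of_forall_lt hd (sigma_pos hd hτ) fun s' hs' hlt => ?_
  have hne : {s : ℝ | 0 < s ∧ (τ, s) ∈ JS d}.Nonempty :=
    ⟨_, (lower_pair_mem_JS hτ).2.1, lower_pair_mem_JS hτ⟩
  obtain ⟨s, hs, hlt'⟩ := exists_lt_of_lt_csSup hne hlt
  exact JS_anti_right hs.2 hs' hlt'.le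

theorem mem_JS_iff (hd : 0 < d) {τ s : ℝ} : (τ, s) ∈ JS d ↔ 0 < τ ∧ 0 < s ∧ s ≤ sigma τ d :=
  ⟨fun h => ⟨h.1, h.2.1, le_sigma hd h⟩,
    fun h => JS_anti_right (sigma_mem_JS hd h.1) h.2.1 h.2.2⟩

theorem sigma_monotoneOn (hd : 0 < d) : MonotoneOn (fun x => sigma x d) (Ioi 0) :=
  fun _ hx _ _ hxy => le_sigma hd (JS_mono_left (sigma_mem_JS hd hx) hxy)

/-- Right continuity: the strict inequality imposed on the two sets for `τ` persists for slightly
larger parameters. -/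
theorem mem_JS_of_forall_gt {τ s : ℝ} (hτ : 0 < τ) (hs : 0 < s)
    (h : ∀ τ', τ < τ' → (τ', s) ∈ JS d) : (τ, s) ∈ JS d := by
  refine ⟨hτ, hs, fun Q hQ E F hE hF hEQ hFQ hEF hlt => ?_⟩
  have hev : ∀ᶠ τ' in 𝓝[>] τ,
      τ' * volume.real ((Q \ E) \ F) < min (volume.real E) (volume.real F) :=
    (((continuous_mul_const (volume.real ((Q \ E) \ F))).tendsto τ).eventually
      (gt_mem_nhds hlt)).filter_mono nhdsWithin_le_nhds
  obtain ⟨τ', hτ', hgt⟩ := (hev.and self_mem_nhdsWithin).exists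
  exact (h τ' hgt).2.2 Q hQ E F hE hF hEQ hFQ hEF hτ'

theorem sigma_continuousAt (hd : 0 < d) {τ : ℝ} (hτ : 0 < τ) :
    ContinuousAt (fun x => sigma x d) τ := by
  have hmono := sigma_monotoneOn hd
  refine tendsto_order.2 ⟨fun c hc => ?_, fun c hc => ?_⟩
  · have hgap : 0 < min (sigma τ d) (sigma τ d - c) :=
      lt_min (sigma_pos hd hτ) (by linarith)
    obtain ⟨n, hn⟩ := exists_nat_gt (2 ^ d / min (sigma τ d) (sigma τ d - c))
    set N := max n 2 with hN
    have hN2 : 2 ≤ N := le_max_right _ _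
    have hNpos : (0 : ℝ) < N := by positivity
    have hlt : 2 ^ d / (N : ℝ) < min (sigma τ d) (sigma τ d - c) := by
      rw [div_lt_iff₀ hNpos, ← div_lt_iff₀' hgap]
      exact hn.trans_le (by exact_mod_cast le_max_left n 2)
    rw [lt_min_iff] at hlt
    have hmem := perturbed_mem_JS hd (sigma_mem_JS hd hτ) hN2 hlt.1
    have hlow : τ * (1 - 1 / N) < τ := by
      have : 0 < τ * (1 / N) := by positivity
      linarith
    filter_upwards [lt_mem_nhds hlow] with x hx
    have h1 := le_sigma hd (JS_mono_left hmem hx.le)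
    linarith [hlt.2]
  · obtain ⟨τ', hτ', hlt⟩ : ∃ τ', τ < τ' ∧ sigma τ' d < c := by
      by_contra! hall
      have hcpos : 0 < c := (sigma_pos hd hτ).trans hc
      have := le_sigma hd (mem_JS_of_forall_gt hτ hcpos fun τ' hτ' =>
        (mem_JS_iff hd).2 ⟨hτ.trans hτ', hcpos, hall τ' hτ'⟩)
      linarith
    filter_upwards [gt_mem_nhds hτ', lt_mem_nhds hτ] with x hx hx0
    exact (hmono hx0 (hτ.trans hτ') hx.le).trans_lt hlt

theorem phi_le {x : ℝ} (hx : 0 < x) : phi x d ≤ x / (1 + 2 * x) / 2 ^ d := by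
  have hsq : √2 ^ 2 = 2 := Real.sq_sqrt zero_le_two
  have h1 : 1 < √2 := by nlinarith [Real.sqrt_nonneg 2]
  rw [div_eq_inv_mul, phi, zpow_neg, zpow_natCast]
  split_ifs with h
  · gcongr ?_ * ?_
    rw [div_le_div_iff₀ (by positivity) (by positivity)]
    nlinarith [pow_pos hx 3]
  · gcongr ?_ * ?_
    rw [le_div_iff₀ (by positivity)]
    push Not at h
    nlinarith

end Sigma

end JohnStromberg

theorem theorem4p9 (d : ℕ) (hd : 0 < d) :
    -- (i) the supremum is attained
    (∀ τ : ℝ, 0 < τ → (τ, JohnStromberg.sigma τ d) ∈ JohnStromberg.JS d) ∧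
    -- (ii) description of the set of pairs
    JohnStromberg.JS d =
      {p : ℝ × ℝ | 0 < p.1 ∧ 0 < p.2 ∧ p.2 ≤ JohnStromberg.sigma p.1 d} ∧
    -- (iii) monotonicity, continuity and bounds on the positive half-line
    MonotoneOn (fun x : ℝ => JohnStromberg.sigma x d) (Set.Ioi 0) ∧
    ContinuousOn (fun x : ℝ => JohnStromberg.sigma x d) (Set.Ioi 0) ∧
    (∀ x : ℝ, 0 < x →
      JohnStromberg.phi x d ≤ JohnStromberg.sigma x d ∧
        JohnStromberg.sigma x d ≤ 1 / (2 + 1 / x)) := by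
  refine ⟨fun τ hτ => JohnStromberg.sigma_mem_JS hd hτ, ?_,
    JohnStromberg.sigma_monotoneOn hd,
    fun x hx => (JohnStromberg.sigma_continuousAt hd hx).continuousWithinAt, fun x hx => ⟨?_, ?_⟩⟩
  · ext ⟨τ, s⟩
    exact JohnStromberg.mem_JS_iff hd
  · exact (JohnStromberg.phi_le hx).trans
      (JohnStromberg.le_sigma hd (JohnStromberg.lower_pair_mem_JS hx))
  · have h : 1 / (2 + 1 / x) = x / (1 + 2 * x) := by field_simp; ring
    rw [h]
    exact JohnStromberg.le_div_of_mem_JS hd (JohnStromberg.sigma_mem_JS hd hx)
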